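/- Let $X$ be a hyperstonean compact space, i.e. a compact Hausdorff extremally disconnected space in which every nonempty open set has positive measure for some finite regular Borel measure on $X$ that vanishes on all nowhere dense sets; let $C(X)$ be the algebra of real-valued continuous functions on $X$. Let $\Omega$ be a set, let $H$ be a real Hilbert space (of arbitrary dimension) with orthonormal basis $(b_i)_{i\in\Xi}$, let $B(H)$ be the algebra of bounded linear operators on $H$ with matrix units $e_{i,j}=\langle b_j,\cdot\rangle b_i$, and let $B_{sk}(H)=\{a\in B(H): a^*=-a\}$. Let $M(\Omega,B(H))$ be the $*$-algebra of all maps $\Omega\to B(H)$ with pointwise operations, and let $M(\Omega,B_{sk}(H))$ be the Lie algebra, with bracket $[a,b]=ab-ba$, of all maps $\Omega\to B_{sk}(H)$. Let $s_{i,j}$ denote the constant map $\Omega\to B_{sk}(H)$ with value $e_{i,j}-e_{j,i}$. Let $\mathcal N$ be a unital real $*$-subalgebra of $M(\Omega,B(H))$ which is a real von Neumann algebra of type I (that is, $\mathcal N$ is $*$-isomorphic to a unital $*$-algebra of bounded operators on some real Hilbert space that equals its double commutant, and it has an abelian projection with central support $1$), whose center is isomorphic to $C(X)$, and which contains $s_{i,j}$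 for all $i\neq j$ in $\Xi$. Let $$\mathcal K=\{a\in\mathcal N: a^*=-a\},$$ a Lie subalgebra of $M(\Omega,B_{sk}(H))$. A spatial derivation of $\mathcal K$ is a derivation $D$ of the Lie algebra $\mathcal K$ for which there is $a\in M(\Omega,B_{sk}(H))$ with $D(x)=ax-xa$ for all $x\in\mathcal K$. A 2-local spatial derivation of $\mathcal K$ is a map $\Delta:\mathcal K\to\mathcal K$, not assumed linear, such that for all $x,y\in\mathcal K$ there is a derivation $D$ of the Lie algebra $\mathcal K$ with $\Delta(x)=D(x)$ and $\Delta(y)=D(y)$, and such that for all $x,y\in\mathcal K$ there is $a\in M(\Omega,B_{sk}(H))$ with $\Delta(x)=ax-xa$ and $\Delta(y)=ay-ya$. Then every 2-local spatial derivation of $\mathcal K$ is a spatial derivation of $\mathcal K$. -/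

import Mathlib

universe w

attribute [local instance 100] LieRing.ofAssociativeRing

/-- A finite Borel measure on a compact space is *normal* if it is regular and vanishes on every
nowhere dense set. -/
structure IsNormalMeasure {X : Type*} [TopologicalSpace X] [MeasurableSpace X]
    (μ : MeasureTheory.Measure X) : Prop where
  finite : MeasureTheory.IsFiniteMeasure μ
  regular : μ.Regular
  null_of_nowhereDense : ∀ A : Set X, IsNowhereDense A → μ A = 0

/-- A *hyperstonean* compact space: compact, Hausdorff, extremally disconnected, and such that
the supports of the normal measures have a dense union, that is, every nonempty open set has
positive measure for some normal measure. -/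
structure IsHyperstonean (X : Type*) [TopologicalSpace X] [MeasurableSpace X] [BorelSpace X] :
    Prop where
  compact : CompactSpace X
  hausdorff : T2Space X
  extremallyDisconnected : ExtremallyDisconnected X
  exists_normalMeasure : ∀ U : Set X, IsOpen U → U.Nonempty →
    ∃ μ : MeasureTheory.Measure X, IsNormalMeasure μ ∧ 0 < μ U

/-- A real unital `*`-algebra is a *real von Neumann algebra* if it is `*`-isomorphic to a unital
`*`-algebra of bounded operators on a real Hilbert space that equals its double commutant. -/
def IsRealVonNeumannAlgebra (N : Type*) [Ring N] [Algebra ℝ N] [Star N] : Prop :=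
  ∃ (G : Type w) (_ : NormedAddCommGroup G) (_ : InnerProductSpace ℝ G) (_ : CompleteSpace G)
    (S : StarSubalgebra ℝ (G →L[ℝ] G)),
    Set.centralizer (Set.centralizer (S : Set (G →L[ℝ] G))) = (S : Set (G →L[ℝ] G)) ∧
      Nonempty (N ≃⋆ₐ[ℝ] S)

/-- A projection `p` of a real `*`-algebra is *abelian* if the self-adjoint elements of the
corner `p N p` commute with one another. (For real algebras one looks at the self-adjoint elements
only: this is the condition that `p` is abelian in the Jordan algebra of self-adjoint elements.) -/
def IsAbelianProjection {N : Type*} [Ring N] [Star N] (p : N) : Prop :=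
  IsStarProjection p ∧
    ∀ x y : N, IsSelfAdjoint x → IsSelfAdjoint y → p * x * p = x → p * y * p = y → x * y = y * x

/-- *Type I*: there is an abelian projection with central support `1`. -/
def IsTypeI (N : Type*) [Ring N] [Star N] : Prop :=
  ∃ p : N, IsAbelianProjection p ∧
    ∀ z : N, z ∈ Set.center N → IsStarProjection z → z * p = p → z = 1

/-- The map `D : B → B` is a *spatial derivation* of the Lie algebra `B`, with respect to `A`:
it is a derivation of `B` implemented by an element of `A`. Here `A` and `B` are Lie algebras of
elements of an associative algebra `M`, with bracket `[a, b] = a b - b a`. -/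
def IsSpatialDerivation {M : Type*} [Ring M] [Algebra ℝ M] (A B : LieSubalgebra ℝ M)
    (D : B → B) : Prop :=
  (∃ δ : LieDerivation ℝ B B, ∀ x, D x = δ x) ∧
    ∃ a ∈ A, ∀ x : B, (D x : M) = a * (x : M) - (x : M) * a

/-- The map `Δ : L → L`, not assumed linear, is a *2-local derivation* of the Lie algebra `L`. -/
def IsTwoLocalDerivation {L : Type*} [LieRing L] [LieAlgebra ℝ L] (Δ : L → L) : Prop :=
  ∀ x y : L, ∃ δ : LieDerivation ℝ L L, Δ x = δ x ∧ Δ y = δ y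

/-- The map `Δ : B → B` is a *2-local spatial derivation* of `B` with respect to derivations
implemented by elements of `A`. -/
def IsTwoLocalSpatialDerivation {M : Type*} [Ring M] [Algebra ℝ M] (A B : LieSubalgebra ℝ M)
    (Δ : B → B) : Prop :=
  IsTwoLocalDerivation Δ ∧
    ∀ x y : B, ∃ a ∈ A, (Δ x : M) = a * (x : M) - (x : M) * a ∧
      (Δ y : M) = a * (y : M) - (y : M) * a

section MatrixValuedMaps

variable (Ω : Type*) {H : Type*} [NormedAddCommGroup H] [InnerProductSpace ℝ H] [CompleteSpace H]

/-- The Lie algebra `M(Ω, B_sk(H))` of all maps from `Ω` to the skew-adjoint bounded operators on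
the real Hilbert space `H`, with pointwise operations, inside the associative algebra of all maps
from `Ω` to `B(H)`. -/
def skewAdjointMaps (H : Type*) [NormedAddCommGroup H] [InnerProductSpace ℝ H] [CompleteSpace H] :
    LieSubalgebra ℝ (Ω → H →L[ℝ] H) where
  carrier := {a | ∀ ω, ContinuousLinearMap.adjoint (a ω) = -a ω}
  zero_mem' := by intro ω; simp
  add_mem' := by
    intro a b ha hb ω
    simp only [Set.mem_ofPred_eq] at ha hb
    simp only [Pi.add_apply, map_add, ha ω, hb ω]
    abel
  smul_mem' := by
    intro c a ha ω
    simp only [Set.mem_ofPred_eq] at ha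
    simp [ha ω]
  lie_mem' := by
    intro a b ha hb
    have ha' : star a = -a := funext ha
    have hb' : star b = -b := funext hb
    have h : star ⁅a, b⁆ = -⁅a, b⁆ := by
      rw [Ring.lie_def, star_sub, star_mul, star_mul, ha', hb']
      noncomm_ring
    exact fun ω => congrFun h ω

variable {Ω}

/-- The Lie algebra of skew-adjoint elements of a `*`-algebra `N` of maps from `Ω` to `B(H)`. -/
def skewAdjointElements (N : StarSubalgebra ℝ (Ω → H →L[ℝ] H)) :
    LieSubalgebra ℝ (Ω → H →L[ℝ] H) where
  carrier := {a | a ∈ N ∧ star a = -a}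
  zero_mem' := ⟨N.zero_mem, by simp⟩
  add_mem' := by
    rintro a b ⟨ha, ha'⟩ ⟨hb, hb'⟩
    refine ⟨N.add_mem ha hb, ?_⟩
    rw [star_add, ha', hb']
    abel
  smul_mem' := by
    rintro c a ⟨ha, ha'⟩
    exact ⟨N.smul_mem ha c, by simp [star_smul, ha']⟩
  lie_mem' := by
    rintro a b ⟨ha, ha'⟩ ⟨hb, hb'⟩
    refine ⟨?_, ?_⟩
    · rw [Ring.lie_def]
      exact N.sub_mem (N.mul_mem ha hb) (N.mul_mem hb ha)
    · rw [Ring.lie_def, star_sub, star_mul, star_mul, ha', hb']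
      noncomm_ring

variable (Ω)

/-- The constant map `ê_{i,j}` whose value is the matrix unit `e_{i,j} : x ↦ ⟪b j, x⟫ b i` of an
orthonormal basis `b` of `H`. -/
noncomputable def matrixUnitMap {Ξ : Type*} (b : HilbertBasis Ξ ℝ H) (i j : Ξ) :
    Ω → H →L[ℝ] H :=
  fun _ => InnerProductSpace.rankOne ℝ (b i) (b j)

/-- The map `s_{i,j} = ê_{i,j} - ê_{j,i}`. -/
noncomputable def skewUnitMap {Ξ : Type*} (b : HilbertBasis Ξ ℝ H) (i j : Ξ) :
    Ω → H →L[ℝ] H :=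
  matrixUnitMap Ω b i j - matrixUnitMap Ω b j i

end MatrixValuedMaps

/-! The problem decouples over `Ω`: elements of `M(Ω, B_sk(H))` are arbitrary maps, so implementing
operators found separately at each `ω` may be chosen independently. At a fixed `ω` only the second
condition on `Δ` is needed. In dimension at most two, skew-adjoint operators commute and `Δ = 0`.

In dimension at least three, the rank two operators `u ∧ v` determine everything. By
`inner_commutator_eq_zero`, the entry of `[a, x]` at orthonormal `u`, `v` depends only on `[a, u ∧
v]`, so a two-locally spatial family vanishing on all `b i ∧ b j` is zero;
`PairwiseSpatial.eq_zero_of_column` reduces this to a single column `b i ∧ b o`. After normalising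
at two members of that column, `u ↦ d (u ∧ b o) (b o)` is skew, hence linear and bounded, and it
implements `d` (`PairwiseSpatial.exists_implementing`).

This needs the constant maps `u ∧ b j`, for every vector `u`, to lie in `N`. Products of skew units
give the matrix units; norm limits are then taken in a concrete representation of `N`
(`const_wedge_mem`). -/

/-! ### Rank two skew operators and their commutators -/

section SkewOperators

variable {H : Type*} [NormedAddCommGroup H] [InnerProductSpace ℝ H]

/-- The operator `u ∧ v : x ↦ ⟪v, x⟫ u - ⟪u, x⟫ v`. -/
noncomputable def wedge (u v : H) : H →L[ℝ] H :=
  InnerProductSpace.rankOne ℝ u v - InnerProductSpace.rankOne ℝ v u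

theorem wedge_apply (u v x : H) : wedge u v x = inner ℝ v x • u - inner ℝ u x • v := by
  simp [wedge]

theorem wedge_swap (u v : H) : wedge v u = -wedge u v := by
  simp [wedge]

theorem wedge_self (u : H) : wedge u u = 0 := by
  simp [wedge]

theorem wedge_add_left (u v x : H) : wedge (u + v) x = wedge u x + wedge v x := by
  simp only [wedge, map_add, add_apply]
  abel

theorem wedge_smul_left (c : ℝ) (u x : H) : wedge (c • u) x = c • wedge u x := by
  ext y
  simp only [wedge_apply, smul_apply, inner_smul_left, smul_sub, smul_smul]
  simp [mul_comm]

/-- A purely algebraic identity, so it survives any `*`-isomorphism and bounds the norm of the image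
of `v ∧ o`. -/
theorem wedge_pow_three (v : H) {o : H} (ho : ‖o‖ = 1) :
    wedge v o * wedge v o * wedge v o = -(‖v‖ ^ 2 - inner ℝ v o ^ 2) • wedge v o := by
  have h1 : inner ℝ o o = (1 : ℝ) := by simp [ho]
  have h2 : inner ℝ v v = ‖v‖ ^ 2 := real_inner_self_eq_norm_sq v
  ext x
  simp only [mul_apply_eq_comp, wedge_apply, smul_apply,
    inner_sub_right, inner_smul_right, h1, h2, real_inner_comm v o]
  module

variable {Ξ : Type*}

theorem eq_zero_of_inner_basis (b : HilbertBasis Ξ ℝ H) {T : H →L[ℝ] H} (h : ∀ i j, inner ℝ (b i) (T (b j)) = 0) :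
    T = 0 := by
  refine ContinuousLinearMap.ext_on (s := Set.range b) ?_ ?_
  · have := b.dense_span
    rw [← Submodule.dense_iff_topologicalClosure_eq_top] at this
    exact this
  · rintro _ ⟨j, rfl⟩
    refine b.repr.injective ?_
    ext i
    rw [b.repr_apply_apply, b.repr_apply_apply, h i j]
    simp

theorem inner_basis_of_ne (b : HilbertBasis Ξ ℝ H) {i j : Ξ} (h : i ≠ j) : inner ℝ (b i) (b j) = 0 :=
  b.orthonormal.2 h

variable [CompleteSpace H]

theorem inner_of_star_eq_neg {a : H →L[ℝ] H} (ha : star a = -a) (u v : H) :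
    inner ℝ (a u) v = -inner ℝ u (a v) := by
  rw [← ContinuousLinearMap.adjoint_inner_right, ← ContinuousLinearMap.star_eq_adjoint, ha]
  simp

theorem inner_self_of_star_eq_neg {a : H →L[ℝ] H} (ha : star a = -a) (u : H) :
    inner ℝ u (a u) = 0 := by
  have := inner_of_star_eq_neg ha u u
  rw [real_inner_comm] at this
  linarith

theorem star_wedge (u v : H) : star (wedge u v) = -wedge u v := by
  simp [wedge, ContinuousLinearMap.star_eq_adjoint]

theorem commutator_wedge {a : H →L[ℝ] H} (ha : star a = -a) (u v : H) :
    a * wedge u v - wedge u v * a = wedge (a u) v + wedge u (a v) := by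
  ext x
  simp only [sub_apply, add_apply,
    mul_apply_eq_comp, wedge_apply, map_sub, map_smul, inner_of_star_eq_neg ha]
  module

/-- An everywhere defined skew-symmetric map is a bounded skew-adjoint operator. -/
theorem exists_continuousLinearMap_of_skew (A : H → H)
    (hA : ∀ u v, inner ℝ (A u) v = -inner ℝ u (A v)) :
    ∃ a : H →L[ℝ] H, star a = -a ∧ ∀ u, a u = A u := by
  let L : H →ₗ[ℝ] H :=
    { toFun := A
      map_add' := fun u v => ext_inner_right ℝ fun x => by
        rw [inner_add_left]; simp only [hA, inner_add_left]; ring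
      map_smul' := fun c u => ext_inner_right ℝ fun x => by
        simp only [RingHom.id_apply, real_inner_smul_left, hA]; ring }
  -- Hellinger–Toeplitz: skew-symmetry makes the graph closed.
  have hL : Continuous L := by
    apply L.continuous_of_seq_closed_graph
    intro s x y hs hLs
    refine ext_inner_right ℝ fun z => ?_
    have h1 : Filter.Tendsto (fun n => inner ℝ (A (s n)) z) Filter.atTop (nhds (inner ℝ y z)) :=
      hLs.inner tendsto_const_nhds
    have h2 : Filter.Tendsto (fun n => inner ℝ (A (s n)) z) Filter.atTop
        (nhds (inner ℝ (A x) z)) := by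
      simp only [hA]
      exact (hs.inner tendsto_const_nhds).neg
    exact tendsto_nhds_unique h1 h2
  refine ⟨⟨L, hL⟩, ?_, fun u => rfl⟩
  rw [ContinuousLinearMap.star_eq_adjoint, eq_comm, ContinuousLinearMap.eq_adjoint_iff]
  intro u v
  change inner ℝ (-(A u)) v = inner ℝ u (A v)
  rw [inner_neg_left, hA, neg_neg]

/-- A skew-adjoint operator commuting with `u ∧ v`, for orthonormal `u` and `v`, acts on the span
of `u` and `v` as a multiple of it. -/
theorem exists_eq_smul_of_wedge_add_wedge_eq_zero {a : H →L[ℝ] H} (ha : star a = -a) {u v : H}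
    (hu : ‖u‖ = 1) (hv : ‖v‖ = 1) (huv : inner ℝ u v = 0)
    (h : wedge (a u) v + wedge u (a v) = 0) : ∃ c : ℝ, a v = c • u ∧ a u = -c • v := by
  have huu : inner ℝ u u = (1 : ℝ) := by simp [hu]
  have hvv : inner ℝ v v = (1 : ℝ) := by simp [hv]
  have hvu : inner ℝ v u = (0 : ℝ) := by rw [real_inner_comm, huv]
  have h1 := congrArg (fun f : H →L[ℝ] H => f u) h
  have h2 := congrArg (fun f : H →L[ℝ] H => f v) h
  simp only [add_apply, wedge_apply, huu, hvu, hvv, huv,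
    zero_apply, inner_of_star_eq_neg ha, inner_self_of_star_eq_neg ha] at h1 h2
  refine ⟨inner ℝ u (a v), ?_, ?_⟩
  · have h3 : inner ℝ v (a u) = -inner ℝ u (a v) := by
      rw [real_inner_comm, inner_of_star_eq_neg ha]
    rw [h3] at h1
    rw [← sub_eq_zero, ← neg_eq_zero, ← h1]
    module
  · rw [← sub_eq_zero, ← h2]
    module

/-- The matrix entry of `[a, x]` at orthonormal `u` and `v` depends only on `[a, u ∧ v]`. -/
theorem inner_commutator_eq_zero {a x : H →L[ℝ] H} (ha : star a = -a) (hx : star x = -x) {u v : H}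
    (hu : ‖u‖ = 1) (hv : ‖v‖ = 1) (huv : inner ℝ u v = 0)
    (h : a * wedge u v - wedge u v * a = 0) : inner ℝ u ((a * x - x * a) v) = 0 := by
  rw [commutator_wedge ha] at h
  obtain ⟨c, h1, h2⟩ := exists_eq_smul_of_wedge_add_wedge_eq_zero ha hu hv huv h
  have h3 : inner ℝ u (a (x v)) = -inner ℝ (a u) (x v) := by
    rw [inner_of_star_eq_neg ha, neg_neg]
  simp [h1, h2, h3, inner_sub_right, inner_smul_right, inner_smul_left,
    inner_self_of_star_eq_neg hx]

/-- In dimension at most two all skew-adjoint operators commute. -/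
theorem commute_of_dimension_le_two (b : HilbertBasis Ξ ℝ H) (hb : ∀ i j k : Ξ, i = j ∨ i = k ∨ j = k)
    {a x : H →L[ℝ] H} (ha : star a = -a) (hx : star x = -x) : a * x - x * a = 0 := by
  refine eq_zero_of_inner_basis b fun i j => ?_
  have hax : star (a * x - x * a) = -(a * x - x * a) := by
    simp only [star_sub, star_mul, ha, hx]
    noncomm_ring
  rcases eq_or_ne i j with rfl | hij
  · exact inner_self_of_star_eq_neg hax _
  refine inner_commutator_eq_zero ha hx (b.orthonormal.1 i) (b.orthonormal.1 j)
    (inner_basis_of_ne b hij) ?_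
  -- With only two indices, `a (b k)` is orthogonal to `b k` and so is a multiple of the other basis
  -- vector.
  have key : ∀ k l, k ≠ l → a (b k) = inner ℝ (b l) (a (b k)) • b l := by
    intro k l hkl
    refine b.repr.injective ?_
    ext m
    rw [b.repr_apply_apply, b.repr_apply_apply, inner_smul_right]
    rcases hb k l m with h | h | h
    · exact absurd h hkl
    · subst h
      rw [inner_self_of_star_eq_neg ha, inner_basis_of_ne b hkl, mul_zero]
    · subst h
      simp [b.orthonormal.1 l]
  rw [commutator_wedge ha, key i j hij, key j i hij.symm]
  ext x
  simp only [add_apply, wedge_apply, real_inner_smul_left, zero_apply]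
  module

end SkewOperators

/-! ### Two-locally spatial families at a single point -/

section TwoLocal

variable {H : Type*} [NormedAddCommGroup H] [InnerProductSpace ℝ H] [CompleteSpace H]
  {Ξ : Type*} {K : Type*}

/-- The pairs `(x k, d k)` are *two-locally spatial*: any two of them are of the form
`(x, [a, x])` for a common skew-adjoint operator `a`. -/
def PairwiseSpatial (x d : K → H →L[ℝ] H) : Prop :=
  ∀ k l, ∃ a : H →L[ℝ] H, star a = -a ∧ d k = a * x k - x k * a ∧ d l = a * x l - x l * a

theorem PairwiseSpatial.sub_commutator {x d : K → H →L[ℝ] H} (h : PairwiseSpatial x d)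
    {a : H →L[ℝ] H} (ha : star a = -a) :
    PairwiseSpatial x (fun k => d k - (a * x k - x k * a)) := by
  intro k l
  obtain ⟨c, hc, h1, h2⟩ := h k l
  refine ⟨c - a, ?_, ?_, ?_⟩
  · rw [star_sub, ha, hc]; abel
  · simp only [h1]; noncomm_ring
  · simp only [h2]; noncomm_ring

theorem PairwiseSpatial.star_eq_neg {x d : K → H →L[ℝ] H} (h : PairwiseSpatial x d)
    (hx : ∀ k, star (x k) = -x k) (k : K) : star (d k) = -d k := by
  obtain ⟨a, ha, h1, -⟩ := h k k
  rw [h1]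
  simp only [star_sub, star_mul, ha, hx]
  noncomm_ring

/-- If `d` vanishes at `u ∧ v`, for orthonormal `u` and `v`, then the matrix entries of its values
at `u` and `v` vanish. -/
theorem PairwiseSpatial.inner_eq_zero {x d : K → H →L[ℝ] H} (h : PairwiseSpatial x d)
    (hx : ∀ k, star (x k) = -x k) {u v : H} (hu : ‖u‖ = 1) (hv : ‖v‖ = 1)
    (huv : inner ℝ u v = 0) {l : K} (hl : x l = wedge u v) (hdl : d l = 0) (k : K) :
    inner ℝ u (d k v) = 0 := by
  obtain ⟨a, ha, h1, h2⟩ := h k l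
  rw [h1]
  exact inner_commutator_eq_zero ha (hx k) hu hv huv (by rw [← hl, ← h2, hdl])

/-- Off-diagonal entries are controlled by the values at `b i ∧ b j`; diagonal ones vanish by
skewness. -/
theorem PairwiseSpatial.eq_zero {x d : K → H →L[ℝ] H} (h : PairwiseSpatial x d)
    (hx : ∀ k, star (x k) = -x k) (b : HilbertBasis Ξ ℝ H)
    (hS : ∀ i j, i ≠ j → ∃ k, x k = wedge (b i) (b j) ∧ d k = 0) (k : K) : d k = 0 := by
  refine eq_zero_of_inner_basis b fun i j => ?_
  rcases eq_or_ne i j with rfl | hij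
  · exact inner_self_of_star_eq_neg (h.star_eq_neg hx k) _
  obtain ⟨l, hl, hdl⟩ := hS i j hij
  exact h.inner_eq_zero hx (b.orthonormal.1 i) (b.orthonormal.1 j) (inner_basis_of_ne b hij)
    hl hdl k

/-- The hypothesis forces every `d k` to kill `b o`. Hence `d (b i ∧ b j)` can be written both as `b
i ∧ y` and as `z ∧ b j`, with `y ⊥ b i` and `z ⊥ b j`, and comparing the two forms gives zero. -/
theorem PairwiseSpatial.eq_zero_of_column {x d : K → H →L[ℝ] H} (h : PairwiseSpatial x d)
    (hx : ∀ k, star (x k) = -x k) (b : HilbertBasis Ξ ℝ H)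
    {W : Ξ → Ξ → K} (hW : ∀ i j, x (W i j) = wedge (b i) (b j)) {o : Ξ}
    (ho : ∀ i, i ≠ o → d (W i o) = 0) (k : K) : d k = 0 := by
  have n1 : ∀ i, ‖b i‖ = 1 := b.orthonormal.1
  have hcol : ∀ k, d k (b o) = 0 := by
    intro k
    refine b.repr.injective ?_
    ext i
    rw [b.repr_apply_apply]
    simp only [map_zero, lp.coeFn_zero, Pi.zero_apply]
    rcases eq_or_ne i o with rfl | hi
    · exact inner_self_of_star_eq_neg (h.star_eq_neg hx k) _
    · exact h.inner_eq_zero hx (n1 i) (n1 o) (inner_basis_of_ne b hi) (hW i o) (ho i hi) k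
  -- an operator implementing `d` at `b i ∧ b j` and at `b i ∧ b o` kills `b i`
  have key : ∀ i j, i ≠ j → i ≠ o → j ≠ o →
      ∃ a : H →L[ℝ] H, star a = -a ∧ a (b i) = 0 ∧ d (W i j) = wedge (b i) (a (b j)) := by
    intro i j hij hi hj
    obtain ⟨a, ha, h1, h2⟩ := h (W i j) (W i o)
    rw [hW, commutator_wedge ha] at h1
    rw [hW, commutator_wedge ha, ho i hi] at h2
    obtain ⟨c, h3, h4⟩ := exists_eq_smul_of_wedge_add_wedge_eq_zero ha (n1 i) (n1 o)
      (inner_basis_of_ne b hi) h2.symm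
    have h5 := hcol (W i j)
    have hji : inner ℝ (a (b j)) (b o) = 0 := by
      rw [inner_of_star_eq_neg ha, h3, inner_smul_right, inner_basis_of_ne b hij.symm]; simp
    rw [h1, add_apply, wedge_apply, wedge_apply, h4, inner_basis_of_ne b hj, hji,
      inner_basis_of_ne b hi, inner_smul_left, real_inner_self_eq_norm_sq, n1] at h5
    have hc : c = 0 := by
      have h6 : c • b j = 0 := by rw [← h5]; simp
      exact (smul_eq_zero.1 h6).resolve_right (b.orthonormal.ne_zero j)
    have h6 : a (b i) = 0 := by rw [h4, hc]; simp
    refine ⟨a, ha, h6, ?_⟩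
    rw [h1, h6]
    ext; simp [wedge_apply]
  have hneg : ∀ i j, d (W i j) = -d (W j i) := by
    intro i j
    obtain ⟨a, ha, h1, h2⟩ := h (W i j) (W j i)
    rw [h1, h2, hW, hW, wedge_swap (b i) (b j)]
    noncomm_ring
  refine h.eq_zero hx b (fun i j hij => ⟨W i j, hW i j, ?_⟩) k
  rcases eq_or_ne j o with rfl | hj
  · exact ho i hij
  rcases eq_or_ne i o with rfl | hi
  · rw [hneg, ho j hj, neg_zero]
  obtain ⟨a, ha, h1, h2⟩ := key i j hij hi hj
  obtain ⟨c, hc, h3, h4⟩ := key j i hij.symm hj hi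
  have h5 : wedge (b i) (a (b j)) = -wedge (b j) (c (b i)) := by rw [← h2, ← h4, hneg]
  -- At `b i` the left side is `-a (b j)` and the right side vanishes.
  have h6 := congrArg (fun f : H →L[ℝ] H => f (b i)) h5
  have h7 : inner ℝ (a (b j)) (b i) = 0 := by rw [inner_of_star_eq_neg ha, h1]; simp
  have h8 : inner ℝ (c (b i)) (b i) = 0 := by
    rw [real_inner_comm, inner_self_of_star_eq_neg hc]
  simp only [neg_apply, wedge_apply, h7, h8, inner_basis_of_ne b hij.symm,
    real_inner_self_eq_norm_sq, n1] at h6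
  have h9 : a (b j) = 0 := by simpa using h6
  rw [h2, h9]
  ext; simp [wedge_apply]

/-- If all rank two operators `u ∧ b j` occur among the `x k` and the dimension is at least three,
then a two-locally spatial family is spatial. -/
theorem PairwiseSpatial.exists_implementing {x d : K → H →L[ℝ] H} (h : PairwiseSpatial x d)
    (hx : ∀ k, star (x k) = -x k) (b : HilbertBasis Ξ ℝ H)
    (hW : ∀ u j, ∃ k, x k = wedge u (b j)) {o p q : Ξ} (hpo : p ≠ o) (hqo : q ≠ o) (hpq : p ≠ q) :
    ∃ a : H →L[ℝ] H, star a = -a ∧ ∀ k, d k = a * x k - x k * a := by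
  have n1 : ∀ i, ‖b i‖ = 1 := b.orthonormal.1
  choose W hW using hW
  -- normalise
  wlog hz : d (W (b p) o) = 0 ∧ d (W (b q) o) = 0 generalizing d
  · obtain ⟨a, ha, h1, h2⟩ := h (W (b p) o) (W (b q) o)
    obtain ⟨c, hc, h3⟩ := this (h.sub_commutator ha) ⟨by rw [h1, sub_self], by rw [h2, sub_self]⟩
    refine ⟨c + a, by rw [star_add, ha, hc]; abel, fun k => ?_⟩
    rw [sub_eq_iff_eq_add.1 (h3 k)]
    noncomm_ring
  obtain ⟨hp, hq⟩ := hz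
  have hval : ∀ (a : H →L[ℝ] H), star a = -a → ∀ u, (wedge (a u) (b o) + wedge u (a (b o))) (b o) =
      a u - inner ℝ (a u) (b o) • b o - inner ℝ u (b o) • a (b o) := by
    intro a ha u
    have h1 : inner ℝ (a (b o)) (b o) = 0 := by
      rw [real_inner_comm, inner_self_of_star_eq_neg ha]
    rw [add_apply, wedge_apply, wedge_apply, h1, real_inner_self_eq_norm_sq, n1]
    module
  -- If `a` implements `d` at `u ∧ b o`, the value at `u` is `P a P u`, with `P` the projection onto
  -- the complement of `b o`. One `a` serves both `u` and `v`, whence skewness.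
  obtain ⟨A, hA, hAd⟩ := exists_continuousLinearMap_of_skew (fun u => d (W u o) (b o)) (by
    intro u v
    obtain ⟨a, ha, h1, h2⟩ := h (W u o) (W v o)
    rw [h1, h2, hW, hW, commutator_wedge ha, commutator_wedge ha, hval a ha, hval a ha]
    have h3 : inner ℝ (b o) (a v) = -inner ℝ v (a (b o)) := by
      rw [real_inner_comm, inner_of_star_eq_neg ha]
    simp only [inner_sub_left, inner_sub_right, real_inner_smul_left, inner_smul_right,
      inner_of_star_eq_neg ha, real_inner_comm (b o), h3]
    ring)
  have hAo : A (b o) = 0 := by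
    obtain ⟨a, ha, h1, -⟩ := h (W (b o) o) (W (b o) o)
    rw [hAd, h1, hW, wedge_self]
    simp
  refine ⟨A, hA, fun k => ?_⟩
  have h' := h.sub_commutator hA
  refine sub_eq_zero.1 (h'.eq_zero_of_column hx b (W := fun i j => W (b i) j)
    (fun i j => hW _ _) (o := o) (fun i hi => ?_) k)
  have hAi : ∀ i, A * wedge (b i) (b o) - wedge (b i) (b o) * A = wedge (A (b i)) (b o) := by
    intro i
    rw [commutator_wedge hA, hAo]
    ext; simp [wedge_apply]
  rw [hW, hAi, sub_eq_zero]
  rcases eq_or_ne i p with rfl | hip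
  · rw [hp, hAd, hp]; ext; simp [wedge_apply]
  rcases eq_or_ne i q with rfl | hiq
  · rw [hq, hAd, hq]; ext; simp [wedge_apply]
  -- The normalisations at `p` and `q` make `a (b o)` a multiple of `b p` and `c (b o)` a multiple
  -- of `b q`. Both operators give the same `d (b i ∧ b o)`, whose entry at `b i`, `b p` is `r` by
  -- the first and `0` by the second.
  obtain ⟨a, ha, h1, h2⟩ := h (W (b i) o) (W (b p) o)
  obtain ⟨c, hc, h3, h4⟩ := h (W (b i) o) (W (b q) o)
  rw [hW, commutator_wedge ha] at h1 h2
  rw [hW, commutator_wedge hc] at h3 h4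
  rw [hp] at h2
  rw [hq] at h4
  obtain ⟨r, hr, -⟩ := exists_eq_smul_of_wedge_add_wedge_eq_zero ha (n1 p) (n1 o)
    (inner_basis_of_ne b hpo) h2.symm
  obtain ⟨s, hs, -⟩ := exists_eq_smul_of_wedge_add_wedge_eq_zero hc (n1 q) (n1 o)
    (inner_basis_of_ne b hqo) h4.symm
  have hr0 : r = 0 := by
    have h5 := congrArg (fun f : H →L[ℝ] H => inner ℝ (b i) (f (b p))) (h1.symm.trans h3)
    simpa [hr, hs, wedge_apply, inner_sub_right, inner_add_right, inner_smul_right,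
      inner_smul_left, inner_basis_of_ne b hi, inner_basis_of_ne b hip, inner_basis_of_ne b hiq,
      inner_basis_of_ne b hpo, inner_basis_of_ne b hpo.symm, inner_basis_of_ne b hpq.symm, n1]
      using h5
  rw [hr0, zero_smul] at hr
  have h6 : A (b i) = a (b i) := by
    rw [hAd, h1, hval a ha, hr, inner_of_star_eq_neg ha, hr]
    simp
  rw [h1, h6, hr]
  ext; simp [wedge_apply]

end TwoLocal

/-! ### Constant rank two maps in the von Neumann algebra -/

section ConstantMaps

theorem exists_ne_ne_of_three {α : Type*} {o p q : α} (hop : o ≠ p) (hoq : o ≠ q) (hpq : p ≠ q)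
    (i j : α) : ∃ k, k ≠ i ∧ k ≠ j := by
  by_contra! h
  have ho := h o
  have hp := h p
  have hq := h q
  by_cases o = i <;> by_cases p = i <;> by_cases q = i <;> simp_all

/-- Multiplying the relation by `y` and applying the C*-identity twice gives `‖y‖ ^ 4 = |r| * ‖y‖ ^
2`. -/
theorem norm_le_of_pow_three_eq {R : Type*} [NormedRing R] [NormedAlgebra ℝ R] [StarRing R]
    [CStarRing R] {y : R} (hy : star y = -y) {r c : ℝ} (h : y * y * y = -r • y) (hc : 0 ≤ c)
    (hr : |r| ≤ c ^ 2) : ‖y‖ ≤ c := by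
  rcases eq_or_ne y 0 with rfl | hne
  · simpa using hc
  have h1 : ‖y * y‖ = ‖y‖ * ‖y‖ := by
    rw [← CStarRing.norm_star_mul_self (x := y), hy, neg_mul, norm_neg]
  have hyy : star (y * y) = y * y := by rw [star_mul, hy, neg_mul_neg]
  have h2 : ‖y * y * (y * y)‖ = ‖y * y‖ * ‖y * y‖ := by
    rw [← CStarRing.norm_star_mul_self (x := y * y), hyy]
  have h3 : y * y * (y * y) = -r • (y * y) := by rw [← mul_assoc, h, smul_mul_assoc]
  rw [h3, norm_smul, norm_neg, Real.norm_eq_abs, h1] at h2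
  have hpos : 0 < ‖y‖ := norm_pos_iff.2 hne
  have h4 : |r| = ‖y‖ ^ 2 := by
    rw [sq]
    exact mul_right_cancel₀ (mul_pos hpos hpos).ne' h2
  exact le_of_sq_le_sq (h4 ▸ hr) hc

variable {H : Type*} [NormedAddCommGroup H] [InnerProductSpace ℝ H] {Ξ : Type*} {Ω : Type*}

theorem rankOne_mul_mul_rankOne (u v : H) (T : H →L[ℝ] H) :
    InnerProductSpace.rankOne ℝ u u * T * InnerProductSpace.rankOne ℝ v v =
      inner ℝ u (T v) • InnerProductSpace.rankOne ℝ u v := by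
  ext x
  simp [smul_smul, mul_comm]

/-- A map whose matrix entries are those of `T` is constant with value `T`. -/
theorem eq_const_of_matrix_entries (b : HilbertBasis Ξ ℝ H) (z : Ω → H →L[ℝ] H) (T : H →L[ℝ] H)
    (hz : ∀ i j, matrixUnitMap Ω b i i * z * matrixUnitMap Ω b j j =
      inner ℝ (b i) (T (b j)) • matrixUnitMap Ω b i j) : z = Function.const Ω T := by
  funext ω
  refine sub_eq_zero.1 (eq_zero_of_inner_basis b fun i j => ?_)
  have h2 : inner ℝ (b i) (z ω (b j)) • InnerProductSpace.rankOne ℝ (b i) (b j) =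
      inner ℝ (b i) (T (b j)) • InnerProductSpace.rankOne ℝ (b i) (b j) :=
    (rankOne_mul_mul_rankOne _ _ _).symm.trans (congrFun (hz i j) ω)
  have h3 := congrArg (fun f : H →L[ℝ] H => inner ℝ (b i) (f (b j))) h2
  simpa [inner_smul_right, inner_sub_right, b.orthonormal.1, sub_eq_zero] using h3

variable [CompleteSpace H]

/-- The skew units generate the matrix units in dimension at least three. -/
theorem matrixUnitMap_mem (b : HilbertBasis Ξ ℝ H) (N : StarSubalgebra ℝ (Ω → H →L[ℝ] H))
    (hs : ∀ i j : Ξ, i ≠ j → skewUnitMap Ω b i j ∈ N) (h3 : ∀ i j : Ξ, ∃ k, k ≠ i ∧ k ≠ j)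
    (i j : Ξ) : matrixUnitMap Ω b i j ∈ N := by
  have n1 : ∀ i, ‖b i‖ = 1 := b.orthonormal.1
  have hne : ∀ i j, i ≠ j → matrixUnitMap Ω b i j ∈ N := by
    intro i j hij
    obtain ⟨k, hki, hkj⟩ := h3 i j
    -- For distinct `i`, `j`, `k`, the other three products of matrix units vanish.
    have h : matrixUnitMap Ω b i j = skewUnitMap Ω b i k * skewUnitMap Ω b k j := by
      ext ω x
      simp [matrixUnitMap, skewUnitMap, inner_sub_right, inner_smul_right, n1,
        inner_basis_of_ne b hij, inner_basis_of_ne b hki.symm, inner_basis_of_ne b hkj]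
    rw [h]
    exact N.mul_mem (hs i k hki.symm) (hs k j hkj)
  rcases eq_or_ne i j with rfl | hij
  · obtain ⟨k, hki, -⟩ := h3 i i
    have h : matrixUnitMap Ω b i i = matrixUnitMap Ω b i k * matrixUnitMap Ω b k i := by
      ext ω x
      simp [matrixUnitMap, n1]
    rw [h]
    exact N.mul_mem (hne i k hki.symm) (hne k i hki)
  · exact hne i j hij

/-- The vectors `v` for which the constant map with value `v ∧ o` belongs to `N`. -/
def wedgeSubmodule (N : StarSubalgebra ℝ (Ω → H →L[ℝ] H)) (o : H) : Submodule ℝ H where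
  carrier := {v | Function.const Ω (wedge v o) ∈ N}
  zero_mem' := by
    have h : Function.const Ω (wedge 0 o) = 0 := by ext; simp [wedge]
    change _ ∈ N
    exact h ▸ zero_mem N
  add_mem' {u v} hu hv := by
    have h : Function.const Ω (wedge (u + v) o) =
        Function.const Ω (wedge u o) + Function.const Ω (wedge v o) := by
      rw [wedge_add_left]; rfl
    change _ ∈ N
    exact h ▸ add_mem hu hv
  smul_mem' c v hv := by
    have h : Function.const Ω (wedge (c • v) o) = c • Function.const Ω (wedge v o) := by
      rw [wedge_smul_left]; rfl
    change _ ∈ N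
    exact h ▸ N.smul_mem hv c

section Representation

variable {G : Type*} [NormedAddCommGroup G] [InnerProductSpace ℝ G] [CompleteSpace G]
  {N : StarSubalgebra ℝ (Ω → H →L[ℝ] H)} {S : StarSubalgebra ℝ (G →L[ℝ] G)}

/-- The image of the constant map with value `v ∧ o` under a `*`-isomorphism. -/
noncomputable def wedgeImage (φ : N ≃⋆ₐ[ℝ] S) (o : H) (v : wedgeSubmodule N o) : G →L[ℝ] G :=
  (φ ⟨Function.const Ω (wedge (v : H) o), v.2⟩ : S)

theorem wedgeImage_sub (φ : N ≃⋆ₐ[ℝ] S) (o : H) (u v : wedgeSubmodule N o) :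
    wedgeImage φ o (u - v) = wedgeImage φ o u - wedgeImage φ o v := by
  simp only [wedgeImage]
  rw [← AddSubgroupClass.coe_sub, ← map_sub]
  congr 2
  ext ω x
  simp only [wedge_apply, Function.const_apply, AddSubgroupClass.coe_sub, Pi.sub_apply,
    sub_apply, inner_sub_left]
  module

theorem norm_wedgeImage_le (φ : N ≃⋆ₐ[ℝ] S) {o : H} (ho : ‖o‖ = 1) (u : wedgeSubmodule N o) :
    ‖wedgeImage φ o u‖ ≤ ‖u‖ := by
  refine norm_le_of_pow_three_eq (r := ‖(u : H)‖ ^ 2 - inner ℝ (u : H) o ^ 2) ?_ ?_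
    (norm_nonneg _) ?_
  · simp only [wedgeImage]
    rw [← StarMemClass.coe_star, ← map_star, ← NegMemClass.coe_neg, ← map_neg]
    congr 2
    ext1
    exact funext fun ω => star_wedge _ _
  · simp only [wedgeImage]
    rw [← MulMemClass.coe_mul, ← MulMemClass.coe_mul, ← map_mul, ← map_mul,
      ← SetLike.val_smul, ← map_smul]
    congr 2
    ext1
    exact funext fun ω => wedge_pow_three _ ho
  · have h1 : |inner ℝ (u : H) o| ≤ ‖(u : H)‖ := by
      simpa [ho] using abs_real_inner_le_norm (u : H) o
    have h2 := sq_le_sq' (neg_le_of_abs_le h1) (le_of_abs_le h1)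
    rw [abs_of_nonneg (by linarith)]
    simp only [Submodule.coe_norm]
    linarith [sq_nonneg (inner ℝ (u : H) o)]

theorem cauchySeq_wedgeImage (φ : N ≃⋆ₐ[ℝ] S) {o : H} (ho : ‖o‖ = 1)
    {t : ℕ → wedgeSubmodule N o} (ht : CauchySeq t) : CauchySeq fun n => wedgeImage φ o (t n) := by
  rw [Metric.cauchySeq_iff'] at ht ⊢
  intro ε hε
  obtain ⟨n₀, hn₀⟩ := ht ε hε
  refine ⟨n₀, fun n hn => ?_⟩
  have h := hn₀ n hn
  rw [dist_eq_norm] at h ⊢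
  rw [← wedgeImage_sub]
  exact (norm_wedgeImage_le φ ho _).trans_lt h

theorem matrixUnit_mul_wedgeImage_mul (φ : N ≃⋆ₐ[ℝ] S) (b : HilbertBasis Ξ ℝ H)
    (he : ∀ i j, matrixUnitMap Ω b i j ∈ N) (o : H) (u : wedgeSubmodule N o) (i j : Ξ) :
    (φ ⟨_, he i i⟩ : G →L[ℝ] G) * wedgeImage φ o u * φ ⟨_, he j j⟩ =
      inner ℝ (b i) (wedge (u : H) o (b j)) • (φ ⟨_, he i j⟩ : G →L[ℝ] G) := by
  simp only [wedgeImage]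
  rw [← MulMemClass.coe_mul, ← MulMemClass.coe_mul, ← map_mul, ← map_mul,
    ← SetLike.val_smul, ← map_smul]
  congr 2
  ext1
  exact funext fun ω => rankOne_mul_mul_rankOne _ _ _

/-- Since `wedgeImage` is contractive, a convergent sequence of vectors gives a norm limit in `S`.
Its preimage in `N` is identified by its matrix entries, which `φ` transports algebraically; no
continuity of `φ.symm` is needed. -/
theorem isClosed_wedgeSubmodule (φ : N ≃⋆ₐ[ℝ] S) (hS : IsClosed (S : Set (G →L[ℝ] G)))
    (b : HilbertBasis Ξ ℝ H) (he : ∀ i j, matrixUnitMap Ω b i j ∈ N) {o : H} (ho : ‖o‖ = 1) :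
    IsClosed (wedgeSubmodule N o : Set H) := by
  refine isClosed_of_closure_subset fun u hu => ?_
  obtain ⟨s, hsV, hs⟩ := mem_closure_iff_seq_limit.1 hu
  let t : ℕ → wedgeSubmodule N o := fun n => ⟨s n, hsV n⟩
  have ht : CauchySeq t :=
    Metric.cauchySeq_iff.2 fun ε hε => Metric.cauchySeq_iff.1 hs.cauchySeq ε hε
  obtain ⟨Y, hY⟩ := cauchySeq_tendsto_of_complete (cauchySeq_wedgeImage φ ho ht)
  have hYS : Y ∈ S := hS.mem_of_tendsto hY (.of_forall fun n => (φ _).2)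
  obtain ⟨z, hz⟩ := EquivLike.surjective φ ⟨Y, hYS⟩
  have hentry : ∀ i j, (φ ⟨_, he i i⟩ : G →L[ℝ] G) * Y * φ ⟨_, he j j⟩ =
      inner ℝ (b i) (wedge u o (b j)) • (φ ⟨_, he i j⟩ : G →L[ℝ] G) := by
    intro i j
    have h1 := (hY.const_mul (φ ⟨_, he i i⟩ : G →L[ℝ] G)).mul_const (φ ⟨_, he j j⟩ : G →L[ℝ] G)
    simp only [matrixUnit_mul_wedgeImage_mul] at h1
    have h2 : Continuous fun v : H => inner ℝ (b i) (wedge v o (b j)) := by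
      simp only [wedge_apply]
      fun_prop
    exact tendsto_nhds_unique h1 (((h2.tendsto u).comp hs).smul_const _)
  have hzu : (z : Ω → H →L[ℝ] H) = Function.const Ω (wedge u o) := by
    refine eq_const_of_matrix_entries b _ _ fun i j => ?_
    have h : (⟨_, he i i⟩ * z * ⟨_, he j j⟩ : N) =
        inner ℝ (b i) (wedge u o (b j)) • ⟨_, he i j⟩ := by
      apply EquivLike.injective φ
      rw [map_mul, map_mul, map_smul, hz]
      exact Subtype.ext (hentry i j)
    exact congrArg Subtype.val h
  change Function.const Ω (wedge u o) ∈ N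
  exact hzu ▸ z.2

end Representation

/-- If the matrix units belong to the von Neumann algebra `N`, so do all constant maps with
value `v ∧ b o`. -/
theorem const_wedge_mem (b : HilbertBasis Ξ ℝ H) (N : StarSubalgebra ℝ (Ω → H →L[ℝ] H))
    (hN : IsRealVonNeumannAlgebra.{w} N) (he : ∀ i j, matrixUnitMap Ω b i j ∈ N) (v : H) (o : Ξ) :
    Function.const Ω (wedge v (b o)) ∈ N := by
  obtain ⟨G, _, _, _, S, hS, ⟨φ⟩⟩ := hN
  have hV := isClosed_wedgeSubmodule φ (hS ▸ Set.isClosed_centralizer _) b he (b.orthonormal.1 o)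
  have hb : Set.range b ⊆ wedgeSubmodule N (b o) := by
    rintro _ ⟨i, rfl⟩
    -- The constant map with value `b i ∧ b o` is a difference of two matrix units.
    exact sub_mem (he i o) (he o i)
  have htop : (⊤ : Submodule ℝ H) ≤ wedgeSubmodule N (b o) :=
    b.dense_span ▸ Submodule.topologicalClosure_minimal _ (Submodule.span_le.2 hb) hV
  exact htop (Submodule.mem_top (x := v))

end ConstantMaps

/-! ### Assembling the pointwise implementing operators -/

/-- A map on `B` with values `[a, x]`, for a fixed `a ∈ A`, is a spatial derivation. -/
theorem isSpatialDerivation_of_commutator {M : Type*} [Ring M] [Algebra ℝ M]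
    {A B : LieSubalgebra ℝ M} {D : B → B} {a : M} (ha : a ∈ A)
    (h : ∀ x : B, (D x : M) = a * (x : M) - (x : M) * a) : IsSpatialDerivation A B D := by
  refine ⟨⟨{ toFun := D, map_add' := fun x y => ?_, map_smul' := fun c x => ?_, leibniz' := ?_ },
    fun x => rfl⟩, a, ha, h⟩
  · apply Subtype.ext
    rw [show ((D x + D y : B) : M) = D x + D y from rfl, h, h, h,
      show ((x + y : B) : M) = x + y from rfl]
    noncomm_ring
  · apply Subtype.ext
    rw [RingHom.id_apply, show ((c • D x : B) : M) = c • (D x : M) from rfl, h, h,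
      show ((c • x : B) : M) = c • (x : M) from rfl, mul_smul_comm, smul_mul_assoc, smul_sub]
  · intro x y
    apply Subtype.ext
    change (D ⁅x, y⁆ : M) = ⁅(x : M), (D y : M)⁆ - ⁅(y : M), (D x : M)⁆
    simp only [h, LieSubalgebra.coe_bracket, Ring.lie_def]
    noncomm_ring

theorem theorem3p5
    {X : Type*} [TopologicalSpace X] [MeasurableSpace X] [BorelSpace X] (hX : IsHyperstonean X)
    {Ω : Type*}
    {H : Type*} [NormedAddCommGroup H] [InnerProductSpace ℝ H] [CompleteSpace H]
    {Ξ : Type*} (b : HilbertBasis Ξ ℝ H)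
    (N : StarSubalgebra ℝ (Ω → H →L[ℝ] H))
    (hN : IsRealVonNeumannAlgebra.{w} N) (hI : IsTypeI N)
    (hcenter : Nonempty (Subalgebra.center ℝ N ≃ₐ[ℝ] C(X, ℝ)))
    (hs : ∀ i j : Ξ, i ≠ j → skewUnitMap Ω b i j ∈ N)
    (Δ : skewAdjointElements N → skewAdjointElements N)
    (hΔ : IsTwoLocalSpatialDerivation (skewAdjointMaps Ω H) (skewAdjointElements N) Δ) :
    IsSpatialDerivation (skewAdjointMaps Ω H) (skewAdjointElements N) Δ := by
  have hskew : ∀ (x : skewAdjointElements N) (ω : Ω),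
      star ((x : Ω → H →L[ℝ] H) ω) = -(x : Ω → H →L[ℝ] H) ω := fun x ω => congrFun x.2.2 ω
  have hpair : ∀ ω, PairwiseSpatial (fun x : skewAdjointElements N => (x : Ω → H →L[ℝ] H) ω)
      (fun x => (Δ x : Ω → H →L[ℝ] H) ω) := by
    intro ω x y
    obtain ⟨a, ha, h1, h2⟩ := hΔ.2 x y
    exact ⟨a ω, ha ω, congrFun h1 ω, congrFun h2 ω⟩
  have key : ∀ ω, ∃ a : H →L[ℝ] H, star a = -a ∧ ∀ x : skewAdjointElements N,
      (Δ x : Ω → H →L[ℝ] H) ω = a * (x : Ω → H →L[ℝ] H) ω - (x : Ω → H →L[ℝ] H) ω * a := by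
    intro ω
    by_cases hdim : ∀ i j k : Ξ, i = j ∨ i = k ∨ j = k
    · refine ⟨0, by simp, fun x => ?_⟩
      obtain ⟨a, ha, h1, -⟩ := hpair ω x x
      refine h1.trans ?_
      rw [commute_of_dimension_le_two b hdim ha (hskew x ω)]
      simp
    · push Not at hdim
      obtain ⟨o, p, q, hop, hoq, hpq⟩ := hdim
      have h3 : ∀ i j : Ξ, ∃ k, k ≠ i ∧ k ≠ j :=
        exists_ne_ne_of_three hop hoq hpq
      refine (hpair ω).exists_implementing (fun x => hskew x ω) b (fun u j => ?_) hop.symm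
        hoq.symm hpq
      exact ⟨⟨Function.const Ω (wedge u (b j)),
        const_wedge_mem b N hN (matrixUnitMap_mem b N hs h3) u j,
        funext fun ω => star_wedge u (b j)⟩, rfl⟩
  choose a ha hda using key
  exact isSpatialDerivation_of_commutator (a := a) (fun ω => ha ω) fun x => funext fun ω => hda ω x
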